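/- Let $\mathbb F$ be a field. A \emph{complex} is a chain complex $V_\bullet=(\cdots\leftarrow V_{n-1}\xleftarrow{\partial_n}V_n\leftarrow\cdots)$, $n\in\mathbb Z$, of finite-dimensional $\mathbb F$-vector spaces which is tempered: all but finitely many $\partial_n$ are isomorphisms. With chain maps as morphisms the complexes form a category $\mathcal C$. For $n\in\mathbb Z$ let $J[n]$ be the complex with $\mathbb F$ in degree $n$ and $0$ elsewhere, and let $K[n]$ be the complex with $\mathbb F$ in degrees $n$ and $n+1$, $0$ elsewhere, and $\partial_{n+1}=1_{\mathbb F}$; these are the interval complexes. A \emph{filtered complex} is a diagram $\cdots\to{}_{p}V_\bullet\to{}_{p+1}V_\bullet\to\cdots$ in $\mathcal C$, indexed by $p\in\mathbb Z$, in which every arrow is monic, all but finitely many arrows are isomorphisms, and ${}_pV_\bullet=0$ for all sufficiently small $p$. Morphisms of filtered complexes are morphisms of diagrams. A filtered complex is \emph{basic} if its colimit in $\mathcal C$ is isomorphic to $J[n]$ or $K[n]$ for some $n\in\mathbb Z$. An object of an additive category is \emph{indecomposable} if it is nonzero and is not the direct sum of two nonzero objects. An additive category is \emph{Krull--Schmidt}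 if every object is a finite direct sum of indecomposable objects and every indecomposable object has a local endomorphism ring. \textbf{Theorem (Categorical Structural Theorem).} The category of filtered complexes over $\mathbb F$ is Krull--Schmidt. A filtered complex is indecomposable if and only if it is basic. -/

import Mathlib

open CategoryTheory CategoryTheory.Limits

universe u

attribute [local instance] CategoryTheory.Limits.hasBinaryBiproducts_of_finite_biproducts

/-- A Krull-Schmidt category.  The ambient category is additive: it is preadditive and has finite
direct sums (in particular a zero object).  Every object is a finite direct sum of indecomposables
(the empty sum is allowed, for the zero object), and every indecomposable object has a local
endomorphism ring (`IsLocalRing` for a possibly noncommutative ring: it is nontrivial, and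
whenever `a + b = 1`, one of `a`, `b` is invertible). -/
structure IsKrullSchmidt (C : Type*) [Category* C] [Preadditive C] [HasFiniteBiproducts C] :
    Prop where
  exists_decomposition (X : C) : ∃ (m : ℕ) (Y : Fin m → C),
    (∀ i, Indecomposable (Y i)) ∧ Nonempty (X ≅ ⨁ Y)
  isLocalRing_end (X : C) : Indecomposable X → IsLocalRing (End X)

section Additive

/-- An arrow `u` compatible with the structure maps of direct sums, and with isomorphisms as
components, is an isomorphism. -/
theorem isIso_of_biprod_components {C : Type*} [Category* C] [Preadditive C]
    {A B S A' B' S' : C} {inl : A ⟶ S} {inr : B ⟶ S} {fst : S ⟶ A} {snd : S ⟶ B}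
    {inl' : A' ⟶ S'} {inr' : B' ⟶ S'} {fst' : S' ⟶ A'} {snd' : S' ⟶ B'}
    (h : fst ≫ inl + snd ≫ inr = 𝟙 S) (h' : fst' ≫ inl' + snd' ≫ inr' = 𝟙 S')
    {a : A ⟶ A'} {b : B ⟶ B'} {u : S ⟶ S'}
    (hl : inl ≫ u = a ≫ inl') (hr : inr ≫ u = b ≫ inr')
    (hf : u ≫ fst' = fst ≫ a) (hs : u ≫ snd' = snd ≫ b) (ha : IsIso a) (hb : IsIso b) :
    IsIso u := by
  refine ⟨fst' ≫ inv a ≫ inl + snd' ≫ inv b ≫ inr, ?_, ?_⟩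
  · simp [Preadditive.comp_add, reassoc_of% hf, reassoc_of% hs, h]
  · simp [Preadditive.add_comp, hl, hr, h']

/-- An arrow `u` compatible with the projections of direct sums, and with monic components, is
monic. -/
theorem mono_of_biprod_components {C : Type*} [Category* C] [Preadditive C]
    {A B S A' B' S' : C} {inl : A ⟶ S} {inr : B ⟶ S} {fst : S ⟶ A} {snd : S ⟶ B}
    {fst' : S' ⟶ A'} {snd' : S' ⟶ B'}
    (h : fst ≫ inl + snd ≫ inr = 𝟙 S)
    {a : A ⟶ A'} {b : B ⟶ B'} {u : S ⟶ S'}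
    (hf : u ≫ fst' = fst ≫ a) (hs : u ≫ snd' = snd ≫ b) (ha : Mono a) (hb : Mono b) :
    Mono u := by
  refine Preadditive.mono_of_cancel_zero _ fun {Z} g hg => ?_
  have h1 : g ≫ fst = 0 := by
    rw [← cancel_mono a, Category.assoc, ← hf, reassoc_of% hg, zero_comp, zero_comp]
  have h2 : g ≫ snd = 0 := by
    rw [← cancel_mono b, Category.assoc, ← hs, reassoc_of% hg, zero_comp, zero_comp]
  rw [← Category.comp_id g, ← h, Preadditive.comp_add, reassoc_of% h1, reassoc_of% h2,
    zero_comp, zero_comp, add_zero]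

/-- A full subcategory given by an isomorphism-invariant property that holds for zero objects and
is stable under binary direct sums has finite direct sums. -/
theorem hasFiniteBiproducts_fullSubcategory {C : Type*} [Category* C] [Preadditive C]
    [HasFiniteBiproducts C] (P : ObjectProperty C) [P.IsClosedUnderIsomorphisms]
    (hzero : ∀ Z : C, IsZero Z → P Z) (hsum : ∀ X Y : C, P X → P Y → P (X ⊞ Y)) :
    HasFiniteBiproducts P.FullSubcategory := by
  have : P.ContainsZero := ⟨_, isZero_zero C, hzero _ (isZero_zero C)⟩
  have : P.IsClosedUnderBinaryProducts := by
    refine ⟨?_⟩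
    rintro X ⟨p⟩
    have hp := hsum _ _ (p.prop_diag_obj ⟨.left⟩) (p.prop_diag_obj ⟨.right⟩)
    have e := IsLimit.conePointUniqueUpToIso
      ((IsLimit.postcomposeHomEquiv (diagramIsoPair p.diag) _).symm p.isLimit)
      (BinaryBiproduct.isLimit _ _)
    exact P.prop_of_iso e.symm hp
  have : P.IsClosedUnderFiniteProducts := ObjectProperty.IsClosedUnderFiniteProducts.mk'
  exact HasFiniteBiproducts.of_hasFiniteProducts

end Additive

namespace FilteredChain

section Complexes

variable (F : Type u) [Field F]

/-- A `ℤ`-graded chain complex of finite-dimensional vector spaces over `F` is tempered if all but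
finitely many of its boundary arrows `∂ₙ : Vₙ ⟶ Vₙ₋₁` are isomorphisms. -/
def isTempered : ObjectProperty (ChainComplex (FGModuleCat.{u} F) ℤ) :=
  fun V => {n : ℤ | ¬ IsIso (V.d n (n - 1))}.Finite

/-- The category of complexes: tempered chain complexes of finite-dimensional vector spaces,
indexed by the integers. -/
abbrev TemperedComplex := (isTempered F).FullSubcategory

theorem isTempered_of_isZero {V : ChainComplex (FGModuleCat.{u} F) ℤ} (S : Set ℤ) (hS : S.Finite)
    (h : ∀ n ∉ S, IsZero (V.X n)) : isTempered F V := by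
  refine (hS.union (hS.image (· + 1))).subset fun n hn => ?_
  by_contra hc
  exact hn ⟨0, (h n fun h1 => hc (Or.inl h1)).eq_of_src _ _,
    (h (n - 1) fun h1 => hc (Or.inr ⟨n - 1, h1, by simp⟩)).eq_of_src _ _⟩

instance : (isTempered F).IsClosedUnderIsomorphisms where
  of_iso {V W} e hV := by
    refine hV.subset fun n hn h => hn ?_
    have : W.d n (n - 1) = e.inv.f n ≫ V.d n (n - 1) ≫ e.hom.f (n - 1) := by simp
    rw [this]
    infer_instance

instance : HasFiniteBiproducts (ChainComplex (FGModuleCat.{u} F) ℤ) :=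
  HasFiniteBiproducts.of_hasFiniteProducts

instance : HasFiniteBiproducts (TemperedComplex F) := by
  refine hasFiniteBiproducts_fullSubcategory (isTempered F) (fun Z hZ => ?_)
    (fun V W hV hW => ?_)
  · exact isTempered_of_isZero F ∅ Set.finite_empty fun n _ =>
      (HomologicalComplex.eval _ _ n).map_isZero hZ
  · refine (hV.union hW).subset fun n hn => ?_
    by_contra hc
    simp only [Set.mem_union, Set.mem_ofPred_eq, not_or, not_not] at hc
    have key (i : ℤ) : (biprod.fst : V ⊞ W ⟶ V).f i ≫ (biprod.inl : V ⟶ V ⊞ W).f i +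
        (biprod.snd : V ⊞ W ⟶ W).f i ≫ (biprod.inr : W ⟶ V ⊞ W).f i = 𝟙 _ := by
      rw [← HomologicalComplex.comp_f, ← HomologicalComplex.comp_f,
        ← HomologicalComplex.add_f_apply, biprod.total, HomologicalComplex.id_f]
    exact hn (isIso_of_biprod_components (key n) (key (n - 1)) (by simp) (by simp) (by simp)
      (by simp) hc.1 hc.2)

/-- The interval complex `J[n]`: the field `F` in degree `n`, and zero in all other degrees. -/
noncomputable def intervalJ (n : ℤ) : TemperedComplex F :=
  ⟨(HomologicalComplex.single (FGModuleCat.{u} F) (ComplexShape.down ℤ) n).obj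
    (FGModuleCat.of F F),
    isTempered_of_isZero F {n} (Set.finite_singleton n) fun _ hi =>
      HomologicalComplex.isZero_single_obj_X _ _ _ _ hi⟩

/-- The interval complex `K[n]`: the field `F` in degrees `n` and `n + 1`, and zero in all other
degrees, with the identity of `F` as boundary arrow from degree `n + 1` to degree `n`. -/
noncomputable def intervalK (n : ℤ) : TemperedComplex F :=
  ⟨HomologicalComplex.double (c := ComplexShape.down ℤ) (i₀ := n + 1) (i₁ := n)
    (𝟙 (FGModuleCat.of F F)) rfl,
    isTempered_of_isZero F {n + 1, n} (Set.toFinite _) fun i hi =>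
      HomologicalComplex.isZero_double_X _ _ i (fun h => hi (Or.inl h))
        (fun h => hi (Or.inr h))⟩

/-- A persistence complex (a diagram `⋯ ⟶ X p ⟶ X (p + 1) ⟶ ⋯` of complexes indexed by the
integers) is filtered if it is tempered (all but finitely many arrows are isomorphisms), bounded
below (`X p` is zero for all sufficiently small `p`), and every arrow is monic. -/
structure IsFilteredComplex (X : ℤ ⥤ TemperedComplex F) : Prop where
  tempered : {p : ℤ | ¬ IsIso (X.map (homOfLE (Int.le_add_one (le_refl p))))}.Finite
  boundedBelow : ∃ j : ℤ, ∀ p ≤ j, IsZero (X.obj p)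
  mono (p : ℤ) : Mono (X.map (homOfLE (Int.le_add_one (le_refl p))))

/-- Being filtered, as a property of objects of the category of persistence complexes. -/
def isFilteredComplex : ObjectProperty (ℤ ⥤ TemperedComplex F) := fun X => IsFilteredComplex F X

/-- The category of filtered complexes, as a full subcategory of the category of diagrams of
complexes indexed by the integers. -/
abbrev FilteredComplex := (isFilteredComplex F).FullSubcategory

instance : (isFilteredComplex F).IsClosedUnderIsomorphisms where
  of_iso {X Y} e hX := by
    have key (p q : ℤ) (h : p ⟶ q) : Y.map h = e.inv.app p ≫ X.map h ≫ e.hom.app q := by simp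
    refine ⟨hX.tempered.subset fun p hp h => hp ?_, ?_, fun p => ?_⟩
    · rw [key]
      infer_instance
    · obtain ⟨j, hj⟩ := hX.boundedBelow
      exact ⟨j, fun p hp => (hj p hp).of_iso (e.symm.app p)⟩
    · have := hX.mono p
      rw [key]
      infer_instance

instance : HasFiniteBiproducts (ℤ ⥤ TemperedComplex F) :=
  HasFiniteBiproducts.of_hasFiniteProducts

/-- The category of filtered complexes has finite direct sums, so it is additive. -/
instance : HasFiniteBiproducts (FilteredComplex F) := by
  refine hasFiniteBiproducts_fullSubcategory (isFilteredComplex F) (fun Z hZ => ?_)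
    (fun X Y hX hY => ?_)
  · have h (p : ℤ) : IsZero (Z.obj p) := ((evaluation _ _).obj p).map_isZero hZ
    refine ⟨?_, ⟨0, fun p _ => h p⟩, fun p => (h p).mono _⟩
    convert Set.finite_empty
    ext p
    simpa using (⟨0, (h p).eq_of_src _ _, (h _).eq_of_src _ _⟩ : IsIso _)
  · have key (p : ℤ) : (biprod.fst : X ⊞ Y ⟶ X).app p ≫ (biprod.inl : X ⟶ X ⊞ Y).app p +
        (biprod.snd : X ⊞ Y ⟶ Y).app p ≫ (biprod.inr : Y ⟶ X ⊞ Y).app p = 𝟙 _ := by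
      rw [← NatTrans.comp_app, ← NatTrans.comp_app, ← NatTrans.app_add, biprod.total,
        NatTrans.id_app]
    refine ⟨(hX.tempered.union hY.tempered).subset fun p hp => ?_, ?_, fun p => ?_⟩
    · by_contra hc
      simp only [Set.mem_union, Set.mem_ofPred_eq, not_or, not_not] at hc
      exact hp (isIso_of_biprod_components (key p) (key (p + 1)) (by simp) (by simp) (by simp)
        (by simp) hc.1 hc.2)
    · obtain ⟨j, hj⟩ := hX.boundedBelow
      obtain ⟨k, hk⟩ := hY.boundedBelow
      refine ⟨min j k, fun p hp => ?_⟩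
      rw [IsZero.iff_id_eq_zero, ← key p, (hj p (hp.trans (min_le_left _ _))).eq_of_src
        ((biprod.inl : X ⟶ X ⊞ Y).app p) 0, (hk p (hp.trans (min_le_right _ _))).eq_of_src
        ((biprod.inr : Y ⟶ X ⊞ Y).app p) 0]
      simp
    · exact mono_of_biprod_components (fst' := (biprod.fst : X ⊞ Y ⟶ X).app (p + 1))
        (snd' := (biprod.snd : X ⊞ Y ⟶ Y).app (p + 1)) (key p) (by simp) (by simp) (hX.mono p) (hY.mono p)

variable {F}

/-- A filtered complex is basic if its colimit, in the category of complexes, exists and is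
isomorphic to one of the interval complexes `J[n]` or `K[n]`. -/
def IsBasic (X : FilteredComplex F) : Prop :=
  ∃ c : Cocone X.obj, Nonempty (IsColimit c) ∧
    ∃ n : ℤ, Nonempty (c.pt ≅ intervalJ F n) ∨ Nonempty (c.pt ≅ intervalK F n)

end Complexes

end FilteredChain

/-!
The heart of the proof is that a nonzero filtered complex `X` has a basic direct summand.  Let `V`
be its colimit, a finite-dimensional complex with an exhaustive filtration by subcomplexes that
vanishes in low filtration degrees.  Take a nonzero cycle `x`, of degree `n`, in the lowest nonzero
step.  If `x` is not a boundary in `V`, choose a linear form `φ` on `Vₙ` with `φ x = 1` that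
vanishes on all boundaries; then `v ↦ φ v • x` is a projector onto a copy of `J[n]`.  If `x` is a
boundary, choose `y` with `d y = x` in the lowest possible step, and choose `φ` with `φ x = 1`
vanishing on the boundaries of the preceding step; then `φ` in degree `n` and `φ ∘ d` in degree
`n + 1` give a projector onto the copy of `K[n]` spanned by `x` and `y`.  In both cases the
projector preserves the filtration (`exists_interval_summand`), so it is induced by an idempotent
endomorphism of `X` (`exists_interval_retract`).

Filtered complexes are closed under retracts among diagrams of complexes, so their category is
idempotent complete, and an indecomposable object has no idempotents besides `0` and `1`.  Hence
the colimit of an indecomposable filtered complex is an interval complex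
(`isBasic_of_indecomposable`).  Conversely, an endomorphism of an interval complex is zero or
invertible.  Since the arrows of `X` are monic and the complexes are finite-dimensional, an
endomorphism of `X` is zero or invertible as soon as its action on the colimit is.  So the
endomorphism ring of a basic filtered complex is local (`IsBasic.isLocalRing_end`), which forces
indecomposability.  Finally, the total dimension of the colimit decreases when summands are split
off, so every filtered complex is a finite direct sum of indecomposables.
-/

/-! ### Idempotents and decompositions in additive categories -/

section Additive

/-- A retract, in the category of arrows, of an isomorphism is an isomorphism. -/
theorem isIso_of_retract {C : Type*} [Category* C] {A B A' B' : C} {i : A ⟶ A'} {r : A' ⟶ A}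
    {j : B ⟶ B'} {s : B' ⟶ B} {f : A ⟶ B} {g : A' ⟶ B'} (hA : i ≫ r = 𝟙 A) (hB : j ≫ s = 𝟙 B)
    (hi : f ≫ j = i ≫ g) (hr : r ≫ f = g ≫ s) [IsIso g] : IsIso f := by
  refine ⟨j ≫ inv g ≫ r, ?_, ?_⟩
  · rw [reassoc_of% hi, IsIso.hom_inv_id_assoc, hA]
  · simp [hr, hB]

theorem isIdempotentComplete_fullSubcategory {C : Type*} [Category* C] [IsIdempotentComplete C]
    (P : ObjectProperty C) [P.IsStableUnderRetracts] :
    IsIdempotentComplete P.FullSubcategory where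
  idempotents_split X p hp := by
    obtain ⟨Y, i, e, h₁, h₂⟩ := IsIdempotentComplete.idempotents_split X.obj p.hom
      (by rw [← ObjectProperty.FullSubcategory.comp_hom, hp])
    exact ⟨⟨Y, P.prop_of_retract ⟨i, e, h₁⟩ X.property⟩, P.homMk i, P.homMk e,
      ObjectProperty.hom_ext _ h₁, ObjectProperty.hom_ext _ h₂⟩

variable {C : Type*} [Category* C] [Preadditive C]

/-- An idempotent other than `1` in a local ring is not a unit, so a decomposition of the identity
into two orthogonal idempotents is trivial. -/
theorem indecomposable_of_isLocalRing_end [HasBinaryBiproducts C] (X : C)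
    (h : IsLocalRing (End X)) : Indecomposable X := by
  refine ⟨fun hX => one_ne_zero (α := End X) (hX.eq_of_src _ _), fun Y Z e => ?_⟩
  -- The idempotents of `X` that project onto `Y` and onto `Z`.
  let a : X ⟶ X := e.hom ≫ (biprod.fst ≫ biprod.inl) ≫ e.inv
  let b : X ⟶ X := e.hom ≫ (biprod.snd ≫ biprod.inr) ≫ e.inv
  have hab : a + b = 𝟙 X := by
    simp only [a, b, ← Preadditive.comp_add, ← Preadditive.add_comp, biprod.total,
      Category.id_comp, Iso.hom_inv_id]
  have hzero : a ≫ b = 0 := by simp [a, b]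
  have hzero' : b ≫ a = 0 := by simp [a, b]
  obtain hu | hu := h.isUnit_or_isUnit_of_add_one (a := (a : End X)) (b := (b : End X)) hab
  · right
    have hu : IsIso a := (isUnit_iff_isIso a).1 hu
    have hb : b = 0 := by rw [← cancel_epi a, hzero, comp_zero]
    rw [IsZero.iff_id_eq_zero]
    have : (biprod.inr : Z ⟶ Y ⊞ Z) ≫ (e.inv ≫ b ≫ e.hom) ≫ biprod.snd = 𝟙 Z := by simp [b]
    rw [← this, hb]
    simp
  · left
    have hu : IsIso b := (isUnit_iff_isIso b).1 hu
    have ha : a = 0 := by rw [← cancel_epi b, hzero', comp_zero]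
    rw [IsZero.iff_id_eq_zero]
    have : (biprod.inl : Y ⟶ Y ⊞ Z) ≫ (e.inv ≫ a ≫ e.hom) ≫ biprod.fst = 𝟙 Y := by simp [a]
    rw [← this, ha]
    simp

theorem CategoryTheory.Indecomposable.idempotent_eq_zero_or_id [HasBinaryBiproducts C]
    [IsIdempotentComplete C] {X : C} (h : Indecomposable X) {e : X ⟶ X} (he : e ≫ e = e) :
    e = 0 ∨ e = 𝟙 X := by
  obtain ⟨Y, i, p, hip, hpi⟩ := IsIdempotentComplete.idempotents_split X e he
  obtain ⟨Z, j, q, hjq, hqj⟩ := IsIdempotentComplete.idempotents_split X (𝟙 X - e)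
    (by simp [Preadditive.comp_sub, Preadditive.sub_comp, he])
  have hj : j ≫ p = 0 := by
    have : j ≫ e = 0 := by
      have h₁ : j ≫ (𝟙 X - e) = j := by rw [← hqj, reassoc_of% hjq]
      simpa [Preadditive.comp_sub] using h₁
    rw [← Category.comp_id p, ← hip, reassoc_of% hpi, reassoc_of% this, zero_comp]
  have hi : i ≫ q = 0 := by
    have : e ≫ q = 0 := by
      have h₁ : (𝟙 X - e) ≫ q = q := by rw [← hqj, Category.assoc, hjq, Category.comp_id]
      simpa [Preadditive.sub_comp] using h₁
    rw [← Category.id_comp i, ← hip, Category.assoc, Category.assoc, reassoc_of% hpi, this,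
      comp_zero]
  let iso : X ≅ Y ⊞ Z :=
    { hom := biprod.lift p q
      inv := biprod.desc i j
      hom_inv_id := by simp [biprod.lift_desc, hpi, hqj]
      inv_hom_id := by
        ext <;> simp [hip, hjq, hi, hj] }
  obtain hY | hZ := h.2 Y Z iso
  · left
    rw [← hpi, hY.eq_of_tgt p 0, zero_comp]
  · right
    rw [eq_comm, ← sub_eq_zero, ← hqj, hZ.eq_of_tgt q 0, zero_comp]

/-- The object `X` is a direct sum of a finite family of indecomposable objects. -/
def HasIndecomposableDecomposition [HasFiniteBiproducts C] (X : C) : Prop :=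
  ∃ (m : ℕ) (Y : Fin m → C), (∀ i, Indecomposable (Y i)) ∧ Nonempty (X ≅ ⨁ Y)

theorem nonempty_biproduct_sum_iso [HasFiniteBiproducts C] {ι κ : Type} [Finite ι] [Finite κ]
    (W : ι ⊕ κ → C) :
    Nonempty ((⨁ fun i => W (.inl i)) ⊞ (⨁ fun k => W (.inr k)) ≅ ⨁ W) := by
  classical
  refine ⟨{
    hom := biprod.desc (biproduct.desc fun i => biproduct.ι W (.inl i))
      (biproduct.desc fun k => biproduct.ι W (.inr k))
    inv := biproduct.desc fun
      | .inl i => biproduct.ι (fun i => W (.inl i)) i ≫ biprod.inl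
      | .inr k => biproduct.ι (fun k => W (.inr k)) k ≫ biprod.inr
    hom_inv_id := ?_
    inv_hom_id := ?_ }⟩
  · apply biprod.hom_ext' <;> (apply biproduct.hom_ext'; intro j; simp)
  · apply biproduct.hom_ext'
    rintro (j | j) <;> simp

theorem HasIndecomposableDecomposition.of_iso_biprod [HasFiniteBiproducts C] {X X₁ X₂ : C}
    (e : X ≅ X₁ ⊞ X₂) (h₁ : HasIndecomposableDecomposition X₁)
    (h₂ : HasIndecomposableDecomposition X₂) : HasIndecomposableDecomposition X := by
  obtain ⟨m, Y, hY, ⟨eY⟩⟩ := h₁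
  obtain ⟨n, Z, hZ, ⟨eZ⟩⟩ := h₂
  obtain ⟨eYZ⟩ := nonempty_biproduct_sum_iso (Sum.elim Y Z)
  refine ⟨m + n, Sum.elim Y Z ∘ finSumFinEquiv.symm, fun i => ?_,
    ⟨e ≪≫ biprod.mapIso eY eZ ≪≫ eYZ ≪≫ (biproduct.reindex finSumFinEquiv.symm _).symm⟩⟩
  rcases h : finSumFinEquiv.symm i with j | j
  · simpa [h] using hY j
  · simpa [h] using hZ j

/-- Splitting off direct summands terminates as soon as there is an additive invariant with values
in the natural numbers that detects the nonzero summands of `X`. -/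
theorem hasIndecomposableDecomposition_of_size [HasFiniteBiproducts C] (size : C → ℕ)
    (hadd : ∀ X Y Z : C, (X ≅ Y ⊞ Z) → size X = size Y + size Z) (X : C)
    (hzero : ∀ Y : C, Retract Y X → size Y = 0 → IsZero Y) :
    HasIndecomposableDecomposition X := by
  induction hn : size X using Nat.strong_induction_on generalizing X with
  | _ n ih =>
    by_cases hX : IsZero X
    · have hZ : IsZero (⨁ (fun i : Fin 0 => i.elim0 (α := C))) := by
        rw [IsZero.iff_id_eq_zero]
        ext j
        exact j.elim0
      exact ⟨0, _, fun i => i.elim0, ⟨hX.iso hZ⟩⟩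
    by_cases hind : Indecomposable X
    · exact ⟨1, fun _ => X, fun _ => hind, ⟨(biproductUniqueIso fun _ : Fin 1 => X).symm⟩⟩
    obtain ⟨Y, Z, e, hY, hZ⟩ : ∃ (Y Z : C) (_ : X ≅ Y ⊞ Z), ¬ IsZero Y ∧ ¬ IsZero Z := by
      by_contra! hc
      exact hind ⟨hX, fun Y Z e => or_iff_not_imp_left.2 fun h => hc Y Z e h⟩
    let rY : Retract Y X := ⟨biprod.inl ≫ e.inv, e.hom ≫ biprod.fst, by simp⟩
    let rZ : Retract Z X := ⟨biprod.inr ≫ e.inv, e.hom ≫ biprod.snd, by simp⟩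
    have hsize := hadd X Y Z e
    have hY0 : size Y ≠ 0 := fun h => hY (hzero Y rY h)
    have hZ0 : size Z ≠ 0 := fun h => hZ (hzero Z rZ h)
    exact .of_iso_biprod e
      (ih _ (by omega) Y (fun W rW => hzero W (rW.trans rY)) rfl)
      (ih _ (by omega) Z (fun W rW => hzero W (rW.trans rZ)) rfl)

end Additive

/-! ### Maps to a two-term complex -/

section IntervalMaps

open HomologicalComplex

variable {C : Type*} [Category* C] [HasZeroMorphisms C] [HasZeroObject C] {ι : Type*}
  {c : ComplexShape ι} {i₀ i₁ : ι} (hi₀₁ : c.Rel i₀ i₁) {A : C} {K : HomologicalComplex C c}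

open scoped Classical in
/-- The map from a complex `K` to the two-term complex `A = A` in degrees `i₀` and `i₁` that is
determined by its component `φ` in degree `i₁`. -/
noncomputable def HomologicalComplex.mkHomToDoubleId (h : i₀ ≠ i₁) (φ : K.X i₁ ⟶ A) :
    K ⟶ double (𝟙 A) hi₀₁ where
  f k :=
    if hk₀ : k = i₀ then
      eqToHom (by rw [hk₀]) ≫ K.d i₀ i₁ ≫ φ ≫ (doubleXIso₀ (𝟙 A) hi₀₁).inv ≫
        eqToHom (by rw [hk₀])
    else if hk₁ : k = i₁ then
      eqToHom (by rw [hk₁]) ≫ φ ≫ (doubleXIso₁ (𝟙 A) hi₀₁ h).inv ≫ eqToHom (by rw [hk₁])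
    else 0
  comm' k₀ k₁ hk := by
    by_cases h₁ : k₁ = i₁
    · subst h₁
      obtain rfl := c.prev_eq hk hi₀₁
      simp [dif_neg h.symm, double_d _ hi₀₁ h]
    · by_cases h₀ : k₁ = i₀
      · subst h₀
        rw [double_d_eq_zero₁ _ _ _ _ h]
        simp
      · apply (isZero_double_X _ hi₀₁ k₁ h₀ h₁).eq_of_tgt

theorem HomologicalComplex.mkHomToDoubleId_f₀ (h : i₀ ≠ i₁) (φ : K.X i₁ ⟶ A) :
    (mkHomToDoubleId hi₀₁ h φ).f i₀ = K.d i₀ i₁ ≫ φ ≫ (doubleXIso₀ (𝟙 A) hi₀₁).inv := by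
  simp [mkHomToDoubleId]

theorem HomologicalComplex.mkHomToDoubleId_f₁ (h : i₀ ≠ i₁) (φ : K.X i₁ ⟶ A) :
    (mkHomToDoubleId hi₀₁ h φ).f i₁ = φ ≫ (doubleXIso₁ (𝟙 A) hi₀₁ h).inv := by
  simp [mkHomToDoubleId, h.symm]

end IntervalMaps

namespace FilteredChain

variable {F : Type u} [Field F]

theorem isIso_of_bijective {A B : FGModuleCat.{u} F} (f : A ⟶ B)
    (hf : Function.Bijective f.hom.hom) : IsIso f :=
  (LinearEquiv.ofBijective f.hom.hom hf).toFGModuleCatIso.isIso_hom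

theorem isIso_or_eq_zero_of_endo_field (g : FGModuleCat.of F F ⟶ FGModuleCat.of F F) :
    IsIso g ∨ g = 0 := by
  by_cases h : g.hom.hom (1 : F) = 0
  · right
    ext
    exact h
  · left
    refine isIso_of_bijective g ?_
    have hinj : Function.Injective (g.hom.hom : F →ₗ[F] F) := by
      rw [injective_iff_map_eq_zero]
      intro a ha
      have : g.hom.hom (a • (1 : F)) = a • g.hom.hom (1 : F) := map_smul _ _ _
      rw [smul_eq_mul, mul_one, ha] at this
      exact (smul_eq_zero.1 this.symm).resolve_right h
    exact ⟨hinj, LinearMap.injective_iff_surjective.1 hinj⟩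

/-! ### Tempered complexes and interval complexes -/

section Tempered

theorem isIso_iff_isIso_f {V W : TemperedComplex F} (f : V ⟶ W) :
    IsIso f ↔ ∀ k, IsIso (f.hom.f k) := by
  rw [← ObjectProperty.isIso_hom_iff]
  exact ⟨fun _ k => inferInstance, fun h => HomologicalComplex.Hom.isIso_of_components _⟩

theorem isZero_iff_isZero_X {V : TemperedComplex F} :
    IsZero V ↔ ∀ k, IsZero (V.obj.X k) := by
  refine ⟨fun h k => ?_, fun h => ?_⟩
  · have := ((isTempered F).ι ⋙ HomologicalComplex.eval _ _ k).map_isZero h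
    exact this
  · rw [IsZero.iff_id_eq_zero]
    ext : 2
    exact (h _).eq_of_src _ _

/-- If `∂ₙ` and `∂ₙ₊₁` are both isomorphisms then so is `0 = ∂ₙ ∂ₙ₊₁`, so `Vₙ` vanishes. -/
theorem finite_not_isZero_X (V : TemperedComplex F) : {n : ℤ | ¬ IsZero (V.obj.X n)}.Finite := by
  refine (V.property.union (V.property.preimage (f := (· + 1))
    (add_left_injective 1).injOn)).subset fun n hn => ?_
  by_contra hc
  simp only [Set.mem_union, Set.mem_preimage, Set.mem_ofPred_eq, not_or, not_not] at hc
  obtain ⟨h₁, h₂⟩ := hc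
  refine hn ?_
  have h₃ : IsIso (V.obj.d (n + 1) n) := by
    rw [add_sub_cancel_right] at h₂
    exact h₂
  rw [IsZero.iff_id_eq_zero, ← cancel_mono (V.obj.d n (n - 1)), ← cancel_epi (V.obj.d (n + 1) n)]
  simp

section Intervals

variable (F) in
/-- The complex `J[n]` has `F` in degree `n`. -/
noncomputable def intervalJXIso (n : ℤ) : (intervalJ F n).obj.X n ≅ FGModuleCat.of F F :=
  HomologicalComplex.singleObjXSelf (ComplexShape.down ℤ) n _

variable (F) in
/-- The complex `K[n]` has `F` in degree `n + 1`. -/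
noncomputable def intervalKXIso₀ (n : ℤ) : (intervalK F n).obj.X (n + 1) ≅ FGModuleCat.of F F :=
  HomologicalComplex.doubleXIso₀ (c := ComplexShape.down ℤ) (i₁ := n) (𝟙 _) rfl

variable (F) in
/-- The complex `K[n]` has `F` in degree `n`. -/
noncomputable def intervalKXIso₁ (n : ℤ) : (intervalK F n).obj.X n ≅ FGModuleCat.of F F :=
  HomologicalComplex.doubleXIso₁ (c := ComplexShape.down ℤ) (i₀ := n + 1) (𝟙 _) rfl (by simp)

theorem isZero_intervalJ_X {n k : ℤ} (h : k ≠ n) : IsZero ((intervalJ F n).obj.X k) :=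
  HomologicalComplex.isZero_single_obj_X _ _ _ _ h

theorem isZero_intervalK_X {n k : ℤ} (h₀ : k ≠ n + 1) (h₁ : k ≠ n) :
    IsZero ((intervalK F n).obj.X k) :=
  HomologicalComplex.isZero_double_X (c := ComplexShape.down ℤ) _ rfl k h₀ h₁

theorem intervalK_d (n : ℤ) : (intervalK F n).obj.d (n + 1) n =
    (intervalKXIso₀ F n).hom ≫ (intervalKXIso₁ F n).inv :=
  (HomologicalComplex.double_d (c := ComplexShape.down ℤ) _ rfl (by simp)).trans
    (congrArg _ (Category.id_comp _))

theorem intervalJ_hom_ext {n : ℤ} {V : TemperedComplex F} {f g : intervalJ F n ⟶ V}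
    (h : f.hom.f n = g.hom.f n) : f = g := by
  ext k : 2
  by_cases hk : k = n
  · subst hk
    exact h
  · exact (isZero_intervalJ_X hk).eq_of_src _ _

theorem intervalK_hom_ext {n : ℤ} {V : TemperedComplex F} {f g : intervalK F n ⟶ V}
    (h₀ : f.hom.f (n + 1) = g.hom.f (n + 1)) : f = g := by
  have : IsIso ((intervalK F n).obj.d (n + 1) n) := by rw [intervalK_d]; infer_instance
  ext k : 2
  by_cases hk₀ : k = n + 1
  · subst hk₀
    exact h₀
  by_cases hk₁ : k = n
  · subst hk₁
    rw [← cancel_epi ((intervalK F k).obj.d (k + 1) k), ← f.hom.comm, ← g.hom.comm, h₀]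
  · exact (isZero_intervalK_X hk₀ hk₁).eq_of_src _ _

/-- The map `K[n] ⟶ V` given by an element `y` of degree `n + 1`. -/
noncomputable def fromIntervalK (V : TemperedComplex F) (n : ℤ) (y : V.obj.X (n + 1)) :
    intervalK F n ⟶ V :=
  (isTempered F).homMk <| HomologicalComplex.mkHomFromDouble (c := ComplexShape.down ℤ) rfl
    (by simp) (FGModuleCat.ofHom (LinearMap.toSpanSingleton F _ y))
    (FGModuleCat.ofHom (LinearMap.toSpanSingleton F _ y) ≫ V.obj.d (n + 1) n)
    (by simp) (by simp)

theorem fromIntervalK_f₀ (V : TemperedComplex F) (n : ℤ) (y : V.obj.X (n + 1)) :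
    (fromIntervalK V n y).hom.f (n + 1) = (intervalKXIso₀ F n).hom ≫
      FGModuleCat.ofHom (LinearMap.toSpanSingleton F (V.obj.X (n + 1)) y) := by
  exact HomologicalComplex.mkHomFromDouble_f₀ (c := ComplexShape.down ℤ) rfl (by simp) _ _
    (by simp) (by simp)

theorem fromIntervalK_f₁ (V : TemperedComplex F) (n : ℤ) (y : V.obj.X (n + 1)) :
    (fromIntervalK V n y).hom.f n = (intervalKXIso₁ F n).hom ≫
      FGModuleCat.ofHom (LinearMap.toSpanSingleton F (V.obj.X (n + 1)) y) ≫
        V.obj.d (n + 1) n := by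
  exact HomologicalComplex.mkHomFromDouble_f₁ (c := ComplexShape.down ℤ) rfl (by simp) _ _
    (by simp) (by simp)

/-- The map `V ⟶ K[n]` given by a linear form `φ` in degree `n`. -/
noncomputable def toIntervalK (V : TemperedComplex F) (n : ℤ) (φ : V.obj.X n →ₗ[F] F) :
    V ⟶ intervalK F n :=
  (isTempered F).homMk <| HomologicalComplex.mkHomToDoubleId (c := ComplexShape.down ℤ) rfl
    (by simp) (A := FGModuleCat.of F F) (FGModuleCat.ofHom φ)

theorem toIntervalK_f₀ (V : TemperedComplex F) (n : ℤ) (φ : V.obj.X n →ₗ[F] F) :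
    (toIntervalK V n φ).hom.f (n + 1) = V.obj.d (n + 1) n ≫
      (FGModuleCat.ofHom φ : V.obj.X n ⟶ FGModuleCat.of F F) ≫ (intervalKXIso₀ F n).inv := by
  exact HomologicalComplex.mkHomToDoubleId_f₀ ..

theorem toIntervalK_f₁ (V : TemperedComplex F) (n : ℤ) (φ : V.obj.X n →ₗ[F] F) :
    (toIntervalK V n φ).hom.f n =
      (FGModuleCat.ofHom φ : V.obj.X n ⟶ FGModuleCat.of F F) ≫ (intervalKXIso₁ F n).inv := by
  exact HomologicalComplex.mkHomToDoubleId_f₁ ..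

theorem toSpanSingleton_comp_d {V : TemperedComplex F} {n : ℤ} {x : V.obj.X n}
    (hx : (V.obj.d n (n - 1)).hom.hom x = 0) (k : ℤ) (hk : (ComplexShape.down ℤ).Rel n k) :
    FGModuleCat.ofHom (LinearMap.toSpanSingleton F (V.obj.X n) x) ≫ V.obj.d n k = 0 := by
  obtain rfl : k = n - 1 := by simp at hk; omega
  ext
  exact (congrArg _ (one_smul F x)).trans hx

theorem d_comp_linearForm {V : TemperedComplex F} {n : ℤ} {φ : V.obj.X n →ₗ[F] F}
    (hφ : ∀ y, φ ((V.obj.d (n + 1) n).hom.hom y) = 0) (k : ℤ)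
    (hk : (ComplexShape.down ℤ).Rel k n) :
    V.obj.d k n ≫ (FGModuleCat.ofHom φ : V.obj.X n ⟶ FGModuleCat.of F F) = 0 := by
  obtain rfl : k = n + 1 := by simp at hk; omega
  ext y
  exact hφ y

/-- The map `J[n] ⟶ V` given by a cycle `x` of degree `n`. -/
noncomputable def fromIntervalJ (V : TemperedComplex F) (n : ℤ) (x : V.obj.X n)
    (hx : (V.obj.d n (n - 1)).hom.hom x = 0) : intervalJ F n ⟶ V :=
  (isTempered F).homMk <| HomologicalComplex.mkHomFromSingle
    (FGModuleCat.ofHom (LinearMap.toSpanSingleton F _ x)) (toSpanSingleton_comp_d hx)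

theorem fromIntervalJ_f (V : TemperedComplex F) (n : ℤ) (x : V.obj.X n)
    (hx : (V.obj.d n (n - 1)).hom.hom x = 0) :
    (fromIntervalJ V n x hx).hom.f n = (intervalJXIso F n).hom ≫
      FGModuleCat.ofHom (LinearMap.toSpanSingleton F (V.obj.X n) x) := by
  exact HomologicalComplex.mkHomFromSingle_f _ (toSpanSingleton_comp_d hx)

/-- The map `V ⟶ J[n]` given by a linear form `φ` in degree `n` that vanishes on boundaries. -/
noncomputable def toIntervalJ (V : TemperedComplex F) (n : ℤ) (φ : V.obj.X n →ₗ[F] F)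
    (hφ : ∀ y, φ ((V.obj.d (n + 1) n).hom.hom y) = 0) : V ⟶ intervalJ F n :=
  (isTempered F).homMk <| HomologicalComplex.mkHomToSingle (A := FGModuleCat.of F F)
    (FGModuleCat.ofHom φ) (d_comp_linearForm hφ)

theorem toIntervalJ_f (V : TemperedComplex F) (n : ℤ) (φ : V.obj.X n →ₗ[F] F)
    (hφ : ∀ y, φ ((V.obj.d (n + 1) n).hom.hom y) = 0) :
    (toIntervalJ V n φ hφ).hom.f n =
      (FGModuleCat.ofHom φ : V.obj.X n ⟶ FGModuleCat.of F F) ≫ (intervalJXIso F n).inv := by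
  exact HomologicalComplex.mkHomToSingle_f _ (d_comp_linearForm hφ)

theorem not_isZero_field : ¬ IsZero (FGModuleCat.of F F) := by
  intro h
  have h1 := congrArg (fun g : FGModuleCat.of F F ⟶ FGModuleCat.of F F => g.hom.hom (1 : F))
    (h.eq_of_src (𝟙 _) 0)
  exact one_ne_zero (α := F) h1

theorem not_isZero_intervalJ (n : ℤ) : ¬ IsZero (intervalJ F n) := fun h =>
  not_isZero_field ((isZero_iff_isZero_X.1 h n).of_iso (intervalJXIso F n).symm)

theorem not_isZero_intervalK (n : ℤ) : ¬ IsZero (intervalK F n) := fun h =>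
  not_isZero_field ((isZero_iff_isZero_X.1 h (n + 1)).of_iso (intervalKXIso₀ F n).symm)

theorem isIso_or_eq_zero_of_iso_field {A : FGModuleCat.{u} F} (e : A ≅ FGModuleCat.of F F)
    (f : A ⟶ A) : IsIso f ∨ f = 0 := by
  have h : f = e.hom ≫ (e.inv ≫ f ≫ e.hom) ≫ e.inv := by simp
  rw [h]
  obtain hi | hi := isIso_or_eq_zero_of_endo_field (e.inv ≫ f ≫ e.hom)
  · exact Or.inl inferInstance
  · simp [hi]

theorem isIso_or_eq_zero_of_endo_intervalJ (n : ℤ) (f : intervalJ F n ⟶ intervalJ F n) :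
    IsIso f ∨ f = 0 := by
  refine (isIso_or_eq_zero_of_iso_field (intervalJXIso F n) (f.hom.f n)).imp (fun hi => ?_)
    fun h => intervalJ_hom_ext h
  rw [isIso_iff_isIso_f]
  intro k
  by_cases hk : k = n
  · subst hk
    exact hi
  · exact ⟨0, (isZero_intervalJ_X hk).eq_of_src _ _, (isZero_intervalJ_X hk).eq_of_src _ _⟩

theorem isIso_or_eq_zero_of_endo_intervalK (n : ℤ) (f : intervalK F n ⟶ intervalK F n) :
    IsIso f ∨ f = 0 := by
  refine (isIso_or_eq_zero_of_iso_field (intervalKXIso₀ F n) (f.hom.f (n + 1))).imp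
    (fun hi => ?_) fun h => intervalK_hom_ext h
  rw [isIso_iff_isIso_f]
  intro k
  by_cases hk₀ : k = n + 1
  · subst hk₀
    exact hi
  by_cases hk₁ : k = n
  · subst hk₁
    have : IsIso ((intervalK F k).obj.d (k + 1) k) := by rw [intervalK_d]; infer_instance
    have h₁ : f.hom.f k = inv ((intervalK F k).obj.d (k + 1) k) ≫ f.hom.f (k + 1) ≫
        (intervalK F k).obj.d (k + 1) k := by
      rw [f.hom.comm, IsIso.inv_hom_id_assoc]
    rw [h₁]
    infer_instance
  · exact ⟨0, (isZero_intervalK_X hk₀ hk₁).eq_of_src _ _,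
      (isZero_intervalK_X hk₀ hk₁).eq_of_src _ _⟩

end Intervals

/-- A monomorphism of tempered complexes is injective in each degree: the maps from `K[n]` detect
the elements of degree `n + 1`. -/
theorem injective_of_mono {V W : TemperedComplex F} (f : V ⟶ W) [Mono f] (k : ℤ) :
    Function.Injective (f.hom.f k).hom.hom := by
  obtain ⟨n, rfl⟩ : ∃ n, k = n + 1 := ⟨k - 1, by simp⟩
  rw [injective_iff_map_eq_zero]
  intro y hy
  have h0 : fromIntervalK V n y ≫ f = 0 := by
    refine intervalK_hom_ext ?_
    rw [ObjectProperty.FullSubcategory.comp_hom, HomologicalComplex.comp_f, fromIntervalK_f₀,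
      Category.assoc]
    refine (congrArg _ ?_).trans comp_zero
    ext
    exact (congrArg _ (one_smul F y)).trans hy
  have h1 : fromIntervalK V n y = 0 := zero_of_comp_mono f h0
  have h2 : FGModuleCat.ofHom (LinearMap.toSpanSingleton F (V.obj.X (n + 1)) y) = 0 := by
    rw [← cancel_epi (intervalKXIso₀ F n).hom, comp_zero]
    refine (fromIntervalK_f₀ V n y).symm.trans ?_
    rw [h1]
    rfl
  have h3 := congrArg (fun g : FGModuleCat.of F F ⟶ V.obj.X (n + 1) => g.hom.hom (1 : F)) h2
  exact (one_smul F y).symm.trans h3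

theorem isIso_of_mono_endo {V : TemperedComplex F} (f : V ⟶ V) [Mono f] : IsIso f := by
  rw [isIso_iff_isIso_f]
  intro k
  have h := injective_of_mono f k
  exact isIso_of_bijective _ ⟨h, LinearMap.injective_iff_surjective.1 h⟩

end Tempered

/-! ### Interval summands of a filtered vector space with differential -/

section IntervalSummands

variable {V : TemperedComplex F} {n : ℤ}

theorem toSpanSingleton_comp_linearForm {A : FGModuleCat.{u} F} {x : A} {φ : A →ₗ[F] F}
    (h : φ x = 1) : FGModuleCat.ofHom (LinearMap.toSpanSingleton F A x) ≫
      (FGModuleCat.ofHom φ : A ⟶ FGModuleCat.of F F) = 𝟙 (FGModuleCat.of F F) := by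
  ext
  exact (congrArg φ (one_smul F x)).trans h

theorem fromIntervalJ_comp_toIntervalJ {x : V.obj.X n} {φ : V.obj.X n →ₗ[F] F}
    (hx : (V.obj.d n (n - 1)).hom.hom x = 0)
    (hφ : ∀ y, φ ((V.obj.d (n + 1) n).hom.hom y) = 0) (h : φ x = 1) :
    fromIntervalJ V n x hx ≫ toIntervalJ V n φ hφ = 𝟙 _ := by
  refine intervalJ_hom_ext ?_
  rw [ObjectProperty.FullSubcategory.comp_hom, HomologicalComplex.comp_f, fromIntervalJ_f,
    toIntervalJ_f, Category.assoc, reassoc_of% (toSpanSingleton_comp_linearForm h),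
    Iso.hom_inv_id]
  rfl

theorem toIntervalJ_comp_fromIntervalJ_apply {x : V.obj.X n} {φ : V.obj.X n →ₗ[F] F}
    (hx : (V.obj.d n (n - 1)).hom.hom x = 0)
    (hφ : ∀ y, φ ((V.obj.d (n + 1) n).hom.hom y) = 0) (v : V.obj.X n) :
    ((toIntervalJ V n φ hφ ≫ fromIntervalJ V n x hx).hom.f n).hom.hom v = φ v • x := by
  rw [ObjectProperty.FullSubcategory.comp_hom, HomologicalComplex.comp_f, fromIntervalJ_f,
    toIntervalJ_f, Category.assoc, Iso.inv_hom_id_assoc]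
  rfl

theorem fromIntervalK_comp_toIntervalK {y : V.obj.X (n + 1)} {φ : V.obj.X n →ₗ[F] F}
    (h : φ ((V.obj.d (n + 1) n).hom.hom y) = 1) :
    fromIntervalK V n y ≫ toIntervalK V n φ = 𝟙 _ := by
  refine intervalK_hom_ext ?_
  have h' : FGModuleCat.ofHom (LinearMap.toSpanSingleton F (V.obj.X (n + 1)) y) ≫
      V.obj.d (n + 1) n ≫ (FGModuleCat.ofHom φ : V.obj.X n ⟶ FGModuleCat.of F F) = 𝟙 _ :=
    toSpanSingleton_comp_linearForm (φ := φ ∘ₗ (V.obj.d (n + 1) n).hom.hom) h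
  rw [ObjectProperty.FullSubcategory.comp_hom, HomologicalComplex.comp_f, fromIntervalK_f₀,
    toIntervalK_f₀, Category.assoc, reassoc_of% h', Iso.hom_inv_id]
  rfl

theorem toIntervalK_comp_fromIntervalK_apply₀ {y : V.obj.X (n + 1)} {φ : V.obj.X n →ₗ[F] F}
    (v : V.obj.X (n + 1)) :
    ((toIntervalK V n φ ≫ fromIntervalK V n y).hom.f (n + 1)).hom.hom v =
      φ ((V.obj.d (n + 1) n).hom.hom v) • y := by
  rw [ObjectProperty.FullSubcategory.comp_hom, HomologicalComplex.comp_f, fromIntervalK_f₀,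
    toIntervalK_f₀, Category.assoc, Category.assoc, Iso.inv_hom_id_assoc]
  rfl

theorem toIntervalK_comp_fromIntervalK_apply₁ {y : V.obj.X (n + 1)} {φ : V.obj.X n →ₗ[F] F}
    (v : V.obj.X n) :
    ((toIntervalK V n φ ≫ fromIntervalK V n y).hom.f n).hom.hom v =
      φ v • (V.obj.d (n + 1) n).hom.hom y := by
  rw [ObjectProperty.FullSubcategory.comp_hom, HomologicalComplex.comp_f, fromIntervalK_f₁,
    toIntervalK_f₁, Category.assoc, Iso.inv_hom_id_assoc]
  exact map_smul (V.obj.d (n + 1) n).hom.hom (φ v) y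

theorem comp_f_apply_eq_zero {B : TemperedComplex F} (r : V ⟶ B) (i : B ⟶ V) {k : ℤ}
    (hB : IsZero (B.obj.X k)) (v : V.obj.X k) : ((r ≫ i).hom.f k).hom.hom v = 0 := by
  rw [ObjectProperty.FullSubcategory.comp_hom, HomologicalComplex.comp_f,
    hB.eq_of_src (i.hom.f k) 0, comp_zero]
  rfl

theorem exists_linearForm {A : Type*} [AddCommGroup A] [Module F A] {p : Submodule F A} {x : A}
    (hx : x ∉ p) : ∃ φ : A →ₗ[F] F, φ x = 1 ∧ ∀ v ∈ p, φ v = 0 := by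
  obtain ⟨f, hf, hp⟩ := p.exists_le_ker_of_notMem hx
  exact ⟨(f x)⁻¹ • f, by simp [hf], fun v hv => by simp [LinearMap.mem_ker.1 (hp hv)]⟩

/-- An increasing exhaustive filtration `L` by subcomplexes, zero in low filtration degrees, on a
nonzero tempered complex admits an interval summand, namely one whose projector preserves the
filtration.  Take a nonzero cycle `x` in the lowest nonzero step of the filtration.  Any projector
onto the line of `x` preserves the filtration, since `x` lies in every nonzero step.  If `x` is
not a boundary, a linear form with `φ x = 1` that vanishes on boundaries splits off the summand
`J[n]` spanned by `x`.  Otherwise pick `y` with `d y = x` in the lowest possible step `q`.  A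
linear form with `φ x = 1` that vanishes on the boundaries of the preceding step splits off the
summand `K[n]` spanned by `y` and `x`, because `φ ∘ d` vanishes on all steps below `q`. -/
theorem exists_interval_summand (hV : ¬ IsZero V) (L : ℤ → ∀ k, Submodule F (V.obj.X k))
    (hmono : ∀ q r, q ≤ r → ∀ k, L q k ≤ L r k)
    (hd : ∀ q k l, ∀ v ∈ L q k, (V.obj.d k l).hom.hom v ∈ L q l)
    (hbot : ∃ j, ∀ q ≤ j, ∀ k, L q k = ⊥) (htop : ∃ P, ∀ k, L P k = ⊤) :
    ∃ (n : ℤ) (B : TemperedComplex F), (B = intervalJ F n ∨ B = intervalK F n) ∧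
      ∃ (i : B ⟶ V) (r : V ⟶ B), i ≫ r = 𝟙 B ∧
        ∀ q k, ∀ v ∈ L q k, ((r ≫ i).hom.f k).hom.hom v ∈ L q k := by
  obtain ⟨j, hj⟩ := hbot
  obtain ⟨P, hP⟩ := htop
  -- The lowest step `p` of the filtration that contains a nonzero vector.
  obtain ⟨p, ⟨m, z, hz, hz0⟩, hp⟩ := Int.exists_least_of_bdd
    (P := fun q => ∃ (k : ℤ) (v : V.obj.X k), v ∈ L q k ∧ v ≠ 0)
    ⟨j, fun q ⟨k, v, hv, hv0⟩ => by
      by_contra! hq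
      rw [hj q hq.le k] at hv
      exact hv0 hv⟩
    ⟨P, by
      by_contra! hc
      refine hV (isZero_iff_isZero_X.2 fun k => ?_)
      rw [IsZero.iff_id_eq_zero]
      ext v
      exact hc k v (by rw [hP]; trivial)⟩
  have hdd (k l l' : ℤ) (v : V.obj.X k) :
      (V.obj.d l l').hom.hom ((V.obj.d k l).hom.hom v) = 0 :=
    congrArg (fun g => g.hom.hom v) (V.obj.d_comp_d k l l')
  obtain ⟨n, x, hx, hx0, hdx⟩ : ∃ (n : ℤ) (x : V.obj.X n), x ∈ L p n ∧ x ≠ 0 ∧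
      (V.obj.d n (n - 1)).hom.hom x = 0 := by
    by_cases h : (V.obj.d m (m - 1)).hom.hom z = 0
    · exact ⟨m, z, hz, hz0, h⟩
    · exact ⟨m - 1, _, hd p m (m - 1) z hz, h, hdd _ _ _ _⟩
  -- The vector `x` lies in every step of the filtration that contains a nonzero vector.
  have hxL (q k : ℤ) (v : V.obj.X k) (hv : v ∈ L q k) (a : V.obj.X k →ₗ[F] F) :
      a v • x ∈ L q n := by
    by_cases hv0 : v = 0
    · simp [hv0]
    · exact Submodule.smul_mem _ _ (hmono p q (hp q ⟨k, v, hv, hv0⟩) n hx)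
  by_cases hbd : ∃ y, (V.obj.d (n + 1) n).hom.hom y = x
  · obtain ⟨q₀, ⟨y, hy, hyx⟩, hq₀⟩ := Int.exists_least_of_bdd
      (P := fun q => ∃ y ∈ L q (n + 1), (V.obj.d (n + 1) n).hom.hom y = x)
      ⟨p, fun q ⟨y, hy, hyx⟩ => hp q ⟨n + 1, y, hy, fun h => hx0 (by rw [← hyx, h, map_zero])⟩⟩
      ⟨P, hbd.imp fun y hy => ⟨by rw [hP]; trivial, hy⟩⟩
    obtain ⟨φ, hφx, hφ⟩ := exists_linearForm (x := x)
      (p := (L (q₀ - 1) (n + 1)).map (V.obj.d (n + 1) n).hom.hom) (fun ⟨y', hy', h⟩ => by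
        have := hq₀ _ ⟨y', hy', h⟩
        omega)
    refine ⟨n, _, Or.inr rfl, fromIntervalK V n y, toIntervalK V n φ,
      fromIntervalK_comp_toIntervalK (by rw [hyx, hφx]), fun q k v hv => ?_⟩
    by_cases hk₀ : k = n + 1
    · subst hk₀
      rw [toIntervalK_comp_fromIntervalK_apply₀]
      by_cases hq : q₀ ≤ q
      · exact Submodule.smul_mem _ _ (hmono q₀ q hq _ hy)
      · rw [hφ _ ⟨v, hmono q (q₀ - 1) (by omega) _ hv, rfl⟩, zero_smul]
        exact zero_mem _
    by_cases hk₁ : k = n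
    · subst hk₁
      rw [toIntervalK_comp_fromIntervalK_apply₁, hyx]
      exact hxL q k v hv φ
    · rw [comp_f_apply_eq_zero _ _ (isZero_intervalK_X hk₀ hk₁)]
      exact zero_mem _
  · obtain ⟨φ, hφx, hφ⟩ := exists_linearForm (x := x)
      (p := LinearMap.range (V.obj.d (n + 1) n).hom.hom) (fun ⟨y, hy⟩ => hbd ⟨y, hy⟩)
    have hφd (y : V.obj.X (n + 1)) : φ ((V.obj.d (n + 1) n).hom.hom y) = 0 := hφ _ ⟨y, rfl⟩
    refine ⟨n, _, Or.inl rfl, fromIntervalJ V n x hdx, toIntervalJ V n φ hφd,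
      fromIntervalJ_comp_toIntervalJ _ _ hφx, fun q k v hv => ?_⟩
    by_cases hk : k = n
    · subst hk
      rw [toIntervalJ_comp_fromIntervalJ_apply]
      exact hxL q k v hv φ
    · rw [comp_f_apply_eq_zero _ _ (isZero_intervalJ_X hk)]
      exact zero_mem _

end IntervalSummands

/-! ### Retracts of complexes and of filtered complexes -/

section Retracts

instance : (isTempered F).IsStableUnderRetracts where
  of_retract {V W} r hW := by
    refine Set.Finite.subset hW fun n hn h => hn ?_
    have h₁ (k : ℤ) : r.i.f k ≫ r.r.f k = 𝟙 _ := by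
      rw [← HomologicalComplex.comp_f, r.retract, HomologicalComplex.id_f]
    exact isIso_of_retract (h₁ n) (h₁ (n - 1)) (r.i.comm _ _).symm (r.r.comm _ _)

instance : (isFilteredComplex F).IsStableUnderRetracts where
  of_retract {X Y} r hY := by
    have h₁ (p : ℤ) : r.i.app p ≫ r.r.app p = 𝟙 _ := by
      rw [← NatTrans.comp_app, r.retract, NatTrans.id_app]
    refine ⟨hY.tempered.subset fun p hp h => hp ?_, ?_, fun p => ?_⟩
    · exact isIso_of_retract (h₁ p) (h₁ (p + 1)) (r.i.naturality _) (r.r.naturality _).symm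
    · obtain ⟨j, hj⟩ := hY.boundedBelow
      refine ⟨j, fun p hp => ?_⟩
      rw [IsZero.iff_id_eq_zero, ← h₁ p, (hj p hp).eq_of_tgt (r.i.app p) 0, zero_comp]
    · have := hY.mono p
      have : Mono (r.i.app p) := mono_of_mono_fac (h₁ p)
      have : Mono (X.map (homOfLE (Int.le_add_one (le_refl p))) ≫ r.i.app (p + 1)) := by
        rw [r.i.naturality]
        infer_instance
      exact mono_of_mono _ (r.i.app (p + 1))

instance : IsIdempotentComplete (TemperedComplex F) :=
  isIdempotentComplete_fullSubcategory (isTempered F)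

instance : IsIdempotentComplete (FilteredComplex F) :=
  isIdempotentComplete_fullSubcategory (isFilteredComplex F)

end Retracts

/-! ### Filtered complexes and their colimits -/

section Diagrams

variable (X : FilteredComplex F)

theorem mono_map {p q : ℤ} (f : p ⟶ q) : Mono (X.obj.map f) := by
  obtain ⟨n, rfl⟩ := Int.le.dest (leOfHom f)
  induction n with
  | zero =>
    obtain rfl : f = eqToHom (by simp) := Subsingleton.elim _ _
    rw [eqToHom_map]
    infer_instance
  | succ n ih =>
    have h₁ := ih (homOfLE (by omega))
    have h₂ := X.property.mono (p + n)
    have hf : f = homOfLE (by omega : p ≤ p + n) ≫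
      homOfLE (Int.le_add_one (le_refl (p + n))) ≫ eqToHom (by push_cast; ring) :=
      Subsingleton.elim _ _
    rw [hf, X.obj.map_comp, X.obj.map_comp, eqToHom_map]
    infer_instance

theorem exists_isEventuallyConstantFrom : ∃ P, X.obj.IsEventuallyConstantFrom P := by
  obtain ⟨b, hb⟩ := X.property.tempered.bddAbove
  refine ⟨b + 1, fun q f => ?_⟩
  obtain ⟨n, rfl⟩ := Int.le.dest (leOfHom f)
  induction n with
  | zero =>
    obtain rfl : f = eqToHom (by simp) := Subsingleton.elim _ _
    rw [eqToHom_map]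
    infer_instance
  | succ n ih =>
    have h₁ := ih (homOfLE (by omega))
    have h₂ : IsIso (X.obj.map (homOfLE (Int.le_add_one (le_refl (b + 1 + n))))) := by
      by_contra hc
      have := hb hc
      omega
    have hf : f = homOfLE (by omega : b + 1 ≤ b + 1 + n) ≫
      homOfLE (Int.le_add_one (le_refl (b + 1 + n))) ≫ eqToHom (by push_cast; ring) :=
      Subsingleton.elim _ _
    rw [hf, X.obj.map_comp, X.obj.map_comp, eqToHom_map]
    infer_instance

variable {X} {P : ℤ} (hP : X.obj.IsEventuallyConstantFrom P)
include hP

/-- An endomorphism of a filtered complex is determined by its action on the colimit: the arrows up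
to the stable range are monic. -/
theorem eq_zero_of_app_eq_zero {f : X ⟶ X} (hf : f.hom.app P = 0) : f = 0 := by
  ext q : 3
  have h₁ : f.hom.app (max q P) = 0 := by
    have := hP (homOfLE (le_max_right q P))
    rw [← cancel_epi (X.obj.map (homOfLE (le_max_right q P))), f.hom.naturality, hf, zero_comp,
      comp_zero]
  have := mono_map X (homOfLE (le_max_left q P))
  rw [← cancel_mono (X.obj.map (homOfLE (le_max_left q P))), ← f.hom.naturality, h₁, comp_zero]
  exact zero_comp.symm

/-- An endomorphism of a filtered complex that is invertible on the colimit is invertible: it is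
monic on each step, and a monic endomorphism of a finite-dimensional complex is invertible. -/
theorem isIso_of_isIso_app {f : X ⟶ X} (hf : IsIso (f.hom.app P)) : IsIso f := by
  have (q : ℤ) : IsIso (f.hom.app q) := by
    have h₁ : IsIso (f.hom.app (max q P)) := by
      have := hP (homOfLE (le_max_right q P))
      have h : f.hom.app (max q P) = inv (X.obj.map (homOfLE (le_max_right q P))) ≫
          f.hom.app P ≫ X.obj.map (homOfLE (le_max_right q P)) := by
        rw [← f.hom.naturality, IsIso.inv_hom_id_assoc]
      rw [h]
      infer_instance
    have := mono_map X (homOfLE (le_max_left q P))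
    have : Mono (f.hom.app q ≫ X.obj.map (homOfLE (le_max_left q P))) := by
      rw [← f.hom.naturality]
      infer_instance
    have : Mono (f.hom.app q) := mono_of_mono _ (X.obj.map (homOfLE (le_max_left q P)))
    exact isIso_of_mono_endo _
  rw [← ObjectProperty.isIso_hom_iff]
  exact NatIso.isIso_of_isIso_app _

theorem isZero_of_isZero_obj (h : IsZero (X.obj.obj P)) : IsZero X := by
  rw [IsZero.iff_id_eq_zero]
  exact eq_zero_of_app_eq_zero hP (h.eq_of_src _ _)

theorem isBasic_iff_of_isEventuallyConstantFrom : IsBasic X ↔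
    ∃ n : ℤ, Nonempty (X.obj.obj P ≅ intervalJ F n) ∨ Nonempty (X.obj.obj P ≅ intervalK F n) := by
  constructor
  · rintro ⟨c, ⟨hc⟩, n, h⟩
    have := hP.isIso_ι_of_isColimit hc
    let e : X.obj.obj P ≅ c.pt := asIso (c.ι.app P)
    exact ⟨n, h.imp (fun ⟨e'⟩ => ⟨e ≪≫ e'⟩) fun ⟨e'⟩ => ⟨e ≪≫ e'⟩⟩
  · exact fun h => ⟨hP.cocone, ⟨hP.isColimitCocone⟩, h⟩

end Diagrams

/-! ### Endomorphisms of basic filtered complexes -/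

section Basic

/-- Every endomorphism of a basic filtered complex is zero or invertible, as this holds for the
interval complexes. -/
theorem IsBasic.isLocalRing_end {X : FilteredComplex F} (hX : IsBasic X) :
    IsLocalRing (End X) := by
  obtain ⟨P, hP⟩ := exists_isEventuallyConstantFrom X
  obtain ⟨B, e, hB0, hB⟩ : ∃ (B : TemperedComplex F) (_ : X.obj.obj P ≅ B), ¬ IsZero B ∧
      ∀ f : B ⟶ B, IsIso f ∨ f = 0 := by
    obtain ⟨n, ⟨⟨e⟩⟩ | ⟨⟨e⟩⟩⟩ := (isBasic_iff_of_isEventuallyConstantFrom hP).1 hX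
    · exact ⟨_, e, not_isZero_intervalJ n, isIso_or_eq_zero_of_endo_intervalJ n⟩
    · exact ⟨_, e, not_isZero_intervalK n, isIso_or_eq_zero_of_endo_intervalK n⟩
  have key (f : X ⟶ X) : IsIso f ∨ f = 0 := by
    have h : f.hom.app P = e.hom ≫ (e.inv ≫ f.hom.app P ≫ e.hom) ≫ e.inv := by simp
    obtain hi | hi := hB (e.inv ≫ f.hom.app P ≫ e.hom)
    · left
      apply isIso_of_isIso_app hP
      rw [h]
      infer_instance
    · right
      apply eq_zero_of_app_eq_zero hP
      rw [h, hi, zero_comp, comp_zero]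
  have hX0 : ¬ IsZero X := fun h => hB0 <| IsZero.of_iso
    (((isFilteredComplex F).ι ⋙ (evaluation _ _).obj P).map_isZero h) e.symm
  exact
    { exists_pair_ne := ⟨0, 1, fun h => hX0 ((IsZero.iff_id_eq_zero X).2 h.symm)⟩
      isUnit_or_isUnit_of_add_one := fun {a b} hab => by
        obtain ha | rfl := key a
        · exact Or.inl ((isUnit_iff_isIso (X := X) a).2 ha)
        · right
          obtain rfl : b = 1 := by simpa using hab
          exact isUnit_one }

end Basic

/-! ### Splitting an interval off a filtered complex -/

section Splitting

/-- A chain map that preserves a subcomplex restricts to it. -/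
theorem exists_restriction {U V : TemperedComplex F} (i : U ⟶ V) [Mono i] (g : V ⟶ V)
    (hg : ∀ k, ∀ v ∈ LinearMap.range (i.hom.f k).hom.hom,
      (g.hom.f k).hom.hom v ∈ LinearMap.range (i.hom.f k).hom.hom) :
    ∃ e : U ⟶ U, e ≫ i = i ≫ g := by
  have hinj := injective_of_mono i
  let e (k : ℤ) : U.obj.X k →ₗ[F] U.obj.X k :=
    (LinearEquiv.ofInjective (i.hom.f k).hom.hom (hinj k)).symm.toLinearMap ∘ₗ
      ((g.hom.f k).hom.hom ∘ₗ (i.hom.f k).hom.hom).codRestrict _ fun v => hg k _ ⟨v, rfl⟩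
  have he (k : ℤ) (v : U.obj.X k) :
      (i.hom.f k).hom.hom (e k v) = (g.hom.f k).hom.hom ((i.hom.f k).hom.hom v) :=
    congrArg Subtype.val (LinearEquiv.apply_symm_apply
      (LinearEquiv.ofInjective (i.hom.f k).hom.hom (hinj k)) _)
  have hi (k l : ℤ) (v : U.obj.X k) : (i.hom.f l).hom.hom ((U.obj.d k l).hom.hom v) =
      (V.obj.d k l).hom.hom ((i.hom.f k).hom.hom v) :=
    congrArg (fun f => f.hom.hom v) (i.hom.comm k l).symm
  have hg' (k l : ℤ) (v : V.obj.X k) : (g.hom.f l).hom.hom ((V.obj.d k l).hom.hom v) =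
      (V.obj.d k l).hom.hom ((g.hom.f k).hom.hom v) :=
    congrArg (fun f => f.hom.hom v) (g.hom.comm k l).symm
  refine ⟨(isTempered F).homMk
    { f := fun k => ConcreteCategory.ofHom (e k)
      comm' := fun k l _ => ?_ }, ?_⟩
  · ext v
    apply hinj l
    change (i.hom.f l).hom.hom ((U.obj.d k l).hom.hom (e k v)) =
      (i.hom.f l).hom.hom (e l ((U.obj.d k l).hom.hom v))
    rw [he, hi, hi, he, hg']
  · ext k v
    exact he k v

/-- A nonzero filtered complex, with colimit `V = X.obj.obj P`, has an idempotent endomorphism that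
acts on `V` as the projector onto an interval complex: the ranges of the arrows to the colimit
form a filtration of `V`, and a chain map that preserves it comes from a unique endomorphism of the
filtered complex. -/
theorem exists_interval_retract {X : FilteredComplex F} (hX : ¬ IsZero X) {P : ℤ}
    (hP : X.obj.IsEventuallyConstantFrom P) :
    ∃ (n : ℤ) (B : TemperedComplex F), (B = intervalJ F n ∨ B = intervalK F n) ∧
      ∃ (i : B ⟶ X.obj.obj P) (r : X.obj.obj P ⟶ B) (e : X ⟶ X), i ≫ r = 𝟙 B ∧
        e.hom.app P = r ≫ i := by
  -- The arrows of a colimit cocone with point `X.obj.obj P`.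
  obtain ⟨c, hw, hcP, hmono⟩ : ∃ c : ∀ q, X.obj.obj q ⟶ X.obj.obj P,
      (∀ (p q : ℤ) (f : p ⟶ q), X.obj.map f ≫ c q = c p) ∧ c P = 𝟙 _ ∧ ∀ q, Mono (c q) := by
    have hw (p q : ℤ) (f : p ⟶ q) : X.obj.map f ≫ hP.coconeιApp q = hP.coconeιApp p :=
      hP.cocone.w f
    refine ⟨hP.coconeιApp, hw, hP.coconeιApp_eq_id, fun q => ?_⟩
    have h₁ : IsIso (hP.coconeιApp (max q P)) :=
      hP.isIso_ι_of_isColimit' hP.isColimitCocone _ (homOfLE (le_max_right q P))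
    have h₂ := mono_map X (homOfLE (le_max_left q P))
    rw [← hw _ _ (homOfLE (le_max_left q P))]
    infer_instance
  obtain ⟨n, B, hB, i, r, hir, hL⟩ := exists_interval_summand (V := X.obj.obj P)
    (fun h => hX (isZero_of_isZero_obj hP h))
    (fun q k => LinearMap.range ((c q).hom.f k).hom.hom)
    (fun p q hpq k => by
      rintro _ ⟨v, rfl⟩
      exact ⟨((X.obj.map (homOfLE hpq)).hom.f k).hom.hom v,
        congrArg (fun f => (f.hom.f k).hom.hom v) (hw _ _ (homOfLE hpq))⟩)
    (fun q k l => by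
      rintro _ ⟨v, rfl⟩
      exact ⟨((X.obj.obj q).obj.d k l).hom.hom v,
        congrArg (fun f => f.hom.hom v) ((c q).hom.comm k l).symm⟩)
    (by
      obtain ⟨j, hj⟩ := X.property.boundedBelow
      refine ⟨j, fun q hq k => ?_⟩
      rw [(hj q hq).eq_of_src (c q) 0]
      exact LinearMap.range_zero)
    ⟨P, fun k => by
      rw [hcP]
      exact LinearMap.range_id⟩
  choose e he using fun q => exists_restriction (c q) (r ≫ i) (hL q)
  refine ⟨n, B, hB, i, r, (isFilteredComplex F).homMk
    { app := e
      naturality := fun p q f => ?_ }, hir, ?_⟩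
  · rw [← cancel_mono (c q), Category.assoc, Category.assoc, he, hw, he, reassoc_of% hw]
  · have h := he P
    rwa [hcP, Category.comp_id, Category.id_comp] at h

/-- The only nonzero idempotent endomorphism of an indecomposable filtered complex is the identity,
so the projector onto an interval complex identifies the colimit with that interval. -/
theorem isBasic_of_indecomposable {X : FilteredComplex F} (hX : Indecomposable X) : IsBasic X := by
  obtain ⟨P, hP⟩ := exists_isEventuallyConstantFrom X
  obtain ⟨n, B, hB, i, r, e, hir, he⟩ := exists_interval_retract hX.1 hP
  have hee : e ≫ e = e := by
    rw [← sub_eq_zero]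
    apply eq_zero_of_app_eq_zero hP
    change e.hom.app P ≫ e.hom.app P - e.hom.app P = 0
    rw [he, Category.assoc, reassoc_of% hir, sub_self]
  obtain rfl | rfl := hX.idempotent_eq_zero_or_id hee
  · exfalso
    have h0 : r ≫ i = 0 := he.symm
    have hB0 : IsZero B := by
      rw [IsZero.iff_id_eq_zero, ← Category.comp_id (𝟙 B), ← hir]
      simp [reassoc_of% h0]
    obtain rfl | rfl := hB
    · exact not_isZero_intervalJ n hB0
    · exact not_isZero_intervalK n hB0
  · have h1 : r ≫ i = 𝟙 _ := he.symm
    let iso : X.obj.obj P ≅ B := ⟨r, i, h1, hir⟩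
    rw [isBasic_iff_of_isEventuallyConstantFrom hP]
    obtain rfl | rfl := hB
    · exact ⟨n, Or.inl ⟨iso⟩⟩
    · exact ⟨n, Or.inr ⟨iso⟩⟩

end Splitting

/-! ### Total dimension and existence of decompositions -/

section Dimension

/-- The functor sending a filtered complex to the part of degree `k` of its `P`-th step. -/
noncomputable abbrev evalAt (P k : ℤ) : FilteredComplex F ⥤ FGModuleCat.{u} F :=
  (isFilteredComplex F).ι ⋙ (evaluation _ _).obj P ⋙ (isTempered F).ι ⋙
    HomologicalComplex.eval _ _ k

instance (P k : ℤ) : (evalAt (F := F) P k).Additive where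

theorem finrank_eq_of_iso_biprod {A B C : FGModuleCat.{u} F} (e : A ≅ B ⊞ C) :
    Module.finrank F A = Module.finrank F B + Module.finrank F C := by
  let i : B ⟶ A := biprod.inl ≫ e.inv
  let j : C ⟶ A := biprod.inr ≫ e.inv
  let p : A ⟶ B := e.hom ≫ biprod.fst
  let q : A ⟶ C := e.hom ≫ biprod.snd
  have hA : p ≫ i + q ≫ j = 𝟙 A := by
    have h : p ≫ i + q ≫ j =
        e.hom ≫ (biprod.fst ≫ biprod.inl + biprod.snd ≫ biprod.inr) ≫ e.inv := by
      simp only [p, q, i, j, Preadditive.add_comp, Preadditive.comp_add, Category.assoc]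
    rw [h, biprod.total]
    simp
  have hip : i ≫ p = 𝟙 B := by simp [i, p]
  have hjq : j ≫ q = 𝟙 C := by simp [j, q]
  have hiq : i ≫ q = 0 := by simp [i, q]
  have hjp : j ≫ p = 0 := by simp [j, p]
  rw [← Module.finrank_prod]
  refine LinearEquiv.finrank_eq (LinearEquiv.ofLinearMap (p.hom.hom.prod q.hom.hom)
    (i.hom.hom.coprod j.hom.hom) ?_ ?_)
  · have h₁ (v : B) : p.hom.hom (i.hom.hom v) = v := congrArg (fun f => f.hom.hom v) hip
    have h₂ (v : C) : q.hom.hom (j.hom.hom v) = v := congrArg (fun f => f.hom.hom v) hjq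
    have h₃ (v : B) : q.hom.hom (i.hom.hom v) = 0 := congrArg (fun f => f.hom.hom v) hiq
    have h₄ (v : C) : p.hom.hom (j.hom.hom v) = 0 := congrArg (fun f => f.hom.hom v) hjp
    ext v <;> simp [h₁, h₂, h₃, h₄]
  · ext v
    exact congrArg (fun f => f.hom.hom v) hA

/-- The total dimension of the colimit is an additive invariant that detects nonzero summands. -/
theorem hasIndecomposableDecomposition (X : FilteredComplex F) :
    HasIndecomposableDecomposition X := by
  obtain ⟨P, hP⟩ := exists_isEventuallyConstantFrom X
  -- The degrees in which the colimit is nonzero.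
  let S := (finite_not_isZero_X (X.obj.obj P)).toFinset
  refine hasIndecomposableDecomposition_of_size
    (fun Y => ∑ k ∈ S, Module.finrank F ((evalAt P k).obj Y)) (fun Y Z W e => ?_) X
    fun Y rY hY => ?_
  · rw [← Finset.sum_add_distrib]
    refine Finset.sum_congr rfl fun k _ => ?_
    have := preservesBinaryBiproducts_of_preservesBiproducts (evalAt (F := F) P k)
    exact finrank_eq_of_iso_biprod ((evalAt P k).mapIso e ≪≫ (evalAt P k).mapBiprod Z W)
  · have hYP : IsZero (Y.obj.obj P) := by
      rw [isZero_iff_isZero_X]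
      intro k
      by_cases hk : k ∈ S
      · have h0 := Finset.sum_eq_zero_iff.1 hY k hk
        have : Subsingleton ((evalAt P k).obj Y) := Module.finrank_zero_iff.1 h0
        rw [IsZero.iff_id_eq_zero]
        ext v
        exact this.elim _ _
      · have hk : IsZero ((evalAt P k).obj X) := by simpa [S] using hk
        have h := (evalAt P k).congr_map rY.retract
        rw [CategoryTheory.Functor.map_comp, CategoryTheory.Functor.map_id] at h
        rw [IsZero.iff_id_eq_zero]
        refine h.symm.trans ?_
        rw [IsZero.eq_of_tgt hk ((evalAt P k).map rY.i) 0, zero_comp]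
        rfl
    have h0 : rY.r ≫ rY.i = 0 := by
      apply eq_zero_of_app_eq_zero hP
      change rY.r.hom.app P ≫ rY.i.hom.app P = 0
      rw [hYP.eq_of_tgt (rY.r.hom.app P) 0, zero_comp]
    rw [IsZero.iff_id_eq_zero, ← cancel_epi rY.r, ← cancel_mono rY.i, Category.comp_id, h0,
      comp_zero, zero_comp]

end Dimension

end FilteredChain

theorem theorem1p6 (F : Type u) [Field F] :
    IsKrullSchmidt (FilteredChain.FilteredComplex F) ∧
      ∀ X : FilteredChain.FilteredComplex F, Indecomposable X ↔ FilteredChain.IsBasic X := by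
  exact ⟨⟨FilteredChain.hasIndecomposableDecomposition, fun _ h =>
    (FilteredChain.isBasic_of_indecomposable h).isLocalRing_end⟩,
    fun X => ⟨FilteredChain.isBasic_of_indecomposable,
      fun h => indecomposable_of_isLocalRing_end X h.isLocalRing_end⟩⟩
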